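/- **Setting.** Let $\mathcal W,\mathcal X,\hat{\mathcal W}$ be measurable spaces, $\mathcal P_W$ a probability measure on $\mathcal W$, $\{\mathcal P_{X|W=w}\}_{w\in\mathcal W}$ a family of probability measures on $\mathcal X$ depending measurably on $w$, and $\ell:\mathcal W\times\hat{\mathcal W}\to[0,\infty)$ a measurable loss function. Let $(W,X)$ have the joint law $\mathcal P_{WX}(dw,dx)=\mathcal P_W(dw)\,\mathcal P_{X|W=w}(dx)$. Define - the Bayesian risk $R_B=\inf_\phi \mathbb E[\ell(W,\phi(X))]\in[0,\infty]$, the infimum being over all measurable $\phi:\mathcal X\to\hat{\mathcal W}$; - the small-ball probability $L_W(\rho)=\sup_{\hat w\in\hat{\mathcal W}}\mathcal P_W(\ell(W,\hat w)<\rho)$; - for $\alpha>1$, Sibson's $\alpha$-mutual information $I_\alpha(W,X)=\inf_{\mathcal Q_X}D_\alpha(\mathcal P_{WX}\|\mathcal P_W\times\mathcal Q_X)$ over all probability measures $\mathcal Q_X$ on $\mathcal X$, where $D_\alpha(\mathcal P\|\mathcal Q)=\frac1{\alpha-1}\log\int p^\alpha q^{1-\alpha}\,d\mu\in[0,\infty]$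 is Rényi's divergence, $p,q$ being the densities of $\mathcal P,\mathcal Q$ with respect to a dominating measure $\mu$; - the maximal leakage $\mathcal L(W\to X)=\sup\log\frac{\mathbb P(U=\hat U)}{\max_u\mathbb P(U=u)}\in[0,\infty]$, the supremum being over all Markov chains $U-W-X-\hat U$ in which $U$ and $\hat U$ take values in a common finite, but arbitrary, alphabet. Use $\log 0=-\infty$, $\exp(-\infty)=0$, $\exp(\infty)=\infty$ and the convention $\infty+(-\infty)=\infty$ (so that the bounds below are vacuous when the information measure is infinite). **Theorem.** For every $\alpha>1$ and every $\rho>0$, $$R_B\;\ge\;\rho\left(1-\exp\left(\frac{\alpha-1}{\alpha}\bigl(I_\alpha(W,X)+\log L_W(\rho)\bigr)\right)\right).$$ Moreover (the case $\alpha\to\infty$), $$R_B\;\ge\;\sup_{\rho>0}\,\rho\Bigl(1-\exp\bigl(\mathcal L(W\to X)+\log L_W(\rho)\bigr)\Bigr).$$ -/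

import Mathlib

open MeasureTheory ProbabilityTheory
open scoped NNReal ENNReal

noncomputable section

namespace BayesBound

variable {Ω 𝓦 𝓧 𝓥 : Type*} [MeasurableSpace Ω] [MeasurableSpace 𝓦] [MeasurableSpace 𝓧]
  [MeasurableSpace 𝓥]

/-- Addition of extended reals with the convention `∞ + (-∞) = (-∞) + ∞ = ∞`
(Mathlib's `+` has `⊤ + ⊥ = ⊥`); in all other cases it is the usual sum. -/
def upperAdd (a b : EReal) : EReal := -(-a + -b)

/-- Rényi's `α`-divergence `D_α(P‖Q) = (α - 1)⁻¹ log ∫ p ^ α q ^ (1 - α) dμ` (for `α > 0`, `α ≠ 1`),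
where `p`, `q` are the densities of `P`, `Q` with respect to the dominating measure `μ = P + Q`.
The integral takes values in `[0, ∞]` and `log 0 = -∞`, `log ∞ = ∞`. -/
def renyiDiv (α : ℝ) (P Q : Measure Ω) : EReal :=
  (((α - 1)⁻¹ : ℝ) : EReal) *
    ENNReal.log (∫⁻ ω, P.rnDeriv (P + Q) ω ^ α * Q.rnDeriv (P + Q) ω ^ (1 - α) ∂(P + Q))

/-- Sibson's mutual information of order `α` of a pair with joint law `P`: the minimum over all
probability measures `Q` on the second space of `D_α(P ‖ P₁ × Q)`, `P₁` the first marginal. -/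
def sibsonMI (α : ℝ) (P : Measure (𝓦 × 𝓧)) : EReal :=
  ⨅ Q : ProbabilityMeasure 𝓧, renyiDiv α P (P.fst.prod (Q : Measure 𝓧))

/-- Maximal leakage from `W` to `X`, for a pair `(W, X)` with joint law `P`:
the supremum of `log (ℙ(U = Û) / max_u ℙ(U = u))` over all Markov chains `U - W - X - Û` where
`U` and `Û` take values in a common finite alphabet, here `Fin n` with `n` arbitrary. Such a chain is
given by the conditional laws `η` of `U` given `W` and `ζ` of `Û` given `X`; the joint law of
`(U, Û)` is then `(η ∥ₖ ζ) ∘ₘ P` and the law of `U` is `η ∘ₘ P.fst`. -/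
def maximalLeakage (P : Measure (𝓦 × 𝓧)) : EReal :=
  ⨆ (n : ℕ) (η : Kernel 𝓦 (Fin n)) (ζ : Kernel 𝓧 (Fin n))
    (_ : IsMarkovKernel η) (_ : IsMarkovKernel ζ),
    ENNReal.log (((η ∥ₖ ζ) ∘ₘ P) {q : Fin n × Fin n | q.1 = q.2} /
      ⨆ u : Fin n, (η ∘ₘ P.fst) {u})

/-- The Bayesian risk `inf_φ E[ℓ(W, φ(X))]`, where `(W, X)` has joint law `P` and `φ` ranges over
all (measurable) estimators. -/
def bayesianRisk (ℓ : 𝓦 → 𝓥 → ℝ≥0) (P : Measure (𝓦 × 𝓧)) : ℝ≥0∞ :=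
  ⨅ (φ : 𝓧 → 𝓥) (_ : Measurable φ), ∫⁻ p, (ℓ p.1 (φ p.2) : ℝ≥0∞) ∂P

/-- The small-ball probability `L_W(ρ) = sup_v P_W(ℓ(W, v) < ρ)`, `π` being the law of `W`. -/
def smallBall (ℓ : 𝓦 → 𝓥 → ℝ≥0) (π : Measure 𝓦) (ρ : ℝ) : ℝ≥0∞ :=
  ⨆ v : 𝓥, π {w | (ℓ w v : ℝ) < ρ}

end BayesBound

end

/-!
By Markov's inequality, `E[ℓ(W, φ(X))] ≥ ρ (1 - P(E))` with `E = {ℓ(W, φ(X)) < ρ}`, and every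
section `E_x` of this event is a small ball, so `P_W(E_x) ≤ L_W(ρ)`. It remains to bound `P(E)` for
an arbitrary event `E` in terms of `s = sup_x P_W(E_x)`.

* Hölder's inequality gives `log P(E) ≤ (α - 1) / α * (D_α(P ‖ P_W × Q) + log (P_W × Q)(E))`, and
  `(P_W × Q)(E) ≤ s` whatever `Q` is.
* If `E` has finitely many distinct sections `S_1, …, S_N`, let `U = k` with probability
  `1_{S_k}(W) / N` and a dummy value otherwise, and guess `U` from `X = x` by the index of `E_x`.
  This succeeds with probability `P(E) / N`, while `P(U = k) ≤ s / N`, so that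
  `P(E) ≤ exp(𝓛(W → X)) * s`. A general `E` is approximated by such sets in the measure
  `P + P_W × P_X`: closeness in `P_W × P_X` keeps the probabilities of the sections below `s + ε`,
  outside a set of small `P_X`-measure.
-/

namespace BayesBound

section UpperAdd

lemma le_upperAdd_iff_sub_le {a b c : EReal} : c ≤ upperAdd a b ↔ c - b ≤ a := by
  unfold upperAdd
  induction b with
  | bot => induction a <;> induction c <;> simp
  | top => simp
  | coe b =>
    rw [EReal.sub_le_iff_le_add (.inl (EReal.coe_ne_bot b)) (.inl (EReal.coe_ne_top b)),
      ← EReal.coe_neg,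
      EReal.neg_add (.inr (EReal.coe_ne_top _)) (.inr (EReal.coe_ne_bot _)), EReal.coe_neg,
      sub_eq_add_neg, neg_neg, neg_neg]

lemma top_upperAdd (b : EReal) : upperAdd ⊤ b = ⊤ :=
  top_le_iff.1 (le_upperAdd_iff_sub_le.2 le_top)

lemma add_le_upperAdd (a b : EReal) : a + b ≤ upperAdd a b :=
  le_upperAdd_iff_sub_le.2 (EReal.sub_le_of_le_add le_rfl)

lemma upperAdd_le_upperAdd_left (a : EReal) {b c : EReal} (h : b ≤ c) :
    upperAdd a b ≤ upperAdd a c :=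
  le_upperAdd_iff_sub_le.2
    ((EReal.sub_le_sub le_rfl h).trans (le_upperAdd_iff_sub_le.1 le_rfl))

lemma le_upperAdd_iInf {ι : Sort*} {D : ι → EReal} {b c : EReal}
    (h : ∀ i, c ≤ upperAdd (D i) b) : c ≤ upperAdd (⨅ i, D i) b :=
  le_upperAdd_iff_sub_le.2 (le_iInf fun i ↦ le_upperAdd_iff_sub_le.1 (h i))

end UpperAdd

section Markov

variable {𝓦 𝓧 𝓥 : Type*} [MeasurableSpace 𝓦] [MeasurableSpace 𝓧] [MeasurableSpace 𝓥]

lemma measurable_loss_comp {ℓ : 𝓦 → 𝓥 → ℝ≥0} (hℓ : Measurable (Function.uncurry ℓ))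
    {φ : 𝓧 → 𝓥} (hφ : Measurable φ) : Measurable fun p : 𝓦 × 𝓧 ↦ ℓ p.1 (φ p.2) :=
  hℓ.comp (measurable_fst.prodMk (hφ.comp measurable_snd))

lemma measurableSet_loss_lt {ℓ : 𝓦 → 𝓥 → ℝ≥0} (hℓ : Measurable (Function.uncurry ℓ))
    {φ : 𝓧 → 𝓥} (hφ : Measurable φ) (ρ : ℝ) :
    MeasurableSet {p : 𝓦 × 𝓧 | (ℓ p.1 (φ p.2) : ℝ) < ρ} :=
  measurableSet_lt (measurable_loss_comp hℓ hφ).coe_nnreal_real measurable_const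

lemma ofReal_mul_one_sub_le_bayesianRisk {ℓ : 𝓦 → 𝓥 → ℝ≥0}
    (hℓ : Measurable (Function.uncurry ℓ)) (P : Measure (𝓦 × 𝓧)) [IsProbabilityMeasure P]
    (ρ : ℝ) {t : ℝ≥0∞}
    (h : ∀ φ : 𝓧 → 𝓥, Measurable φ → P {p | (ℓ p.1 (φ p.2) : ℝ) < ρ} ≤ t) :
    ENNReal.ofReal ρ * (1 - t) ≤ bayesianRisk ℓ P := by
  refine le_iInf₂ fun φ hφ ↦ ?_
  calc ENNReal.ofReal ρ * (1 - t)
      ≤ ENNReal.ofReal ρ * P {p | (ℓ p.1 (φ p.2) : ℝ) < ρ}ᶜ := by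
        rw [prob_compl_eq_one_sub (measurableSet_loss_lt hℓ hφ ρ)]
        gcongr
        exact h φ hφ
    _ ≤ ENNReal.ofReal ρ * P {p | ENNReal.ofReal ρ ≤ (ℓ p.1 (φ p.2) : ℝ≥0∞)} := by
        gcongr
        exact fun p hp ↦ ENNReal.ofReal_le_of_le_toReal (not_lt.1 hp)
    _ ≤ ∫⁻ p, (ℓ p.1 (φ p.2) : ℝ≥0∞) ∂P :=
        mul_meas_ge_le_lintegral (measurable_loss_comp hℓ hφ).coe_nnreal_ennreal _

lemma coe_mul_one_sub_le_bayesianRisk {ℓ : 𝓦 → 𝓥 → ℝ≥0}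
    (hℓ : Measurable (Function.uncurry ℓ)) (P : Measure (𝓦 × 𝓧)) [IsProbabilityMeasure P]
    {ρ : ℝ} (hρ : 0 ≤ ρ) {t : ℝ≥0∞}
    (h : ∀ φ : 𝓧 → 𝓥, Measurable φ → P {p | (ℓ p.1 (φ p.2) : ℝ) < ρ} ≤ t) :
    (ρ : EReal) * (1 - (t : EReal)) ≤ (bayesianRisk ℓ P : EReal) := by
  have hsub : (1 : EReal) - t ≤ ((1 - t : ℝ≥0∞) : EReal) :=
    EReal.sub_le_of_le_add (by exact_mod_cast le_tsub_add)
  calc (ρ : EReal) * (1 - (t : EReal)) ≤ ρ * ((1 - t : ℝ≥0∞) : EReal) :=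
        mul_le_mul_of_nonneg_left hsub (EReal.coe_nonneg.2 hρ)
    _ = ((ENNReal.ofReal ρ * (1 - t) : ℝ≥0∞) : EReal) := by
        rw [EReal.coe_ennreal_mul, EReal.coe_ennreal_ofReal, max_eq_left hρ]
    _ ≤ bayesianRisk ℓ P :=
        EReal.coe_ennreal_le_coe_ennreal_iff.2 (ofReal_mul_one_sub_le_bayesianRisk hℓ P ρ h)

end Markov

section Renyi

variable {Ω 𝓦 𝓧 : Type*} [MeasurableSpace Ω] [MeasurableSpace 𝓦] [MeasurableSpace 𝓧] {α : ℝ}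

lemma rpow_mul_rpow_rpow_inv_mul_rpow (hα : 1 < α) {x y : ℝ≥0∞} (hy : y ≠ ∞)
    (hxy : x ^ α * y ^ (1 - α) ≠ ∞) :
    (x ^ α * y ^ (1 - α)) ^ α⁻¹ * y ^ ((α - 1) / α) = x := by
  have hα0 : 0 < α := by linarith
  rcases eq_or_ne y 0 with rfl | hy0
  · have hx : x = 0 := by
      by_contra hx
      refine hxy ?_
      rw [ENNReal.zero_rpow_of_neg (by linarith), ENNReal.mul_top]
      simp [hx, hα0.le]
    simp [hx, hα0]
  · have hexp : (1 - α) * α⁻¹ + (α - 1) / α = 0 := by field_simp; ring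
    rw [ENNReal.mul_rpow_of_nonneg _ _ (inv_nonneg.2 hα0.le), ENNReal.rpow_rpow_inv hα0.ne',
      ← ENNReal.rpow_mul, mul_assoc, ← ENNReal.rpow_add _ _ hy0 hy, hexp, ENNReal.rpow_zero,
      mul_one]

lemma lintegral_le_lintegral_rpow_mul_rpow (hα : 1 < α) {μ : Measure Ω} {p q : Ω → ℝ≥0∞}
    (hp : AEMeasurable p μ) (hq : AEMeasurable q μ) (hq_top : ∀ᵐ ω ∂μ, q ω ≠ ∞)
    (hpq : ∫⁻ ω, p ω ^ α * q ω ^ (1 - α) ∂μ ≠ ∞) :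
    ∫⁻ ω, p ω ∂μ ≤
      (∫⁻ ω, p ω ^ α * q ω ^ (1 - α) ∂μ) ^ α⁻¹ * (∫⁻ ω, q ω ∂μ) ^ ((α - 1) / α) := by
  have hα0 : 0 < α := by linarith
  have hpq_meas : AEMeasurable (fun ω ↦ p ω ^ α * q ω ^ (1 - α)) μ :=
    (hp.pow_const α).mul (hq.pow_const (1 - α))
  calc ∫⁻ ω, p ω ∂μ
      = ∫⁻ ω, (p ω ^ α * q ω ^ (1 - α)) ^ α⁻¹ * q ω ^ ((α - 1) / α) ∂μ := by
        refine lintegral_congr_ae ?_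
        filter_upwards [hq_top, ae_lt_top' hpq_meas hpq] with ω hqω hpqω
        exact (rpow_mul_rpow_rpow_inv_mul_rpow hα hqω hpqω.ne).symm
    _ ≤ _ := ENNReal.lintegral_mul_norm_pow_le hpq_meas hq (inv_nonneg.2 hα0.le)
        (div_nonneg (by linarith) hα0.le) (by field_simp; ring)

lemma measure_le_lintegral_rnDeriv_rpow_mul_rpow (hα : 1 < α) (P Q : Measure Ω)
    [SigmaFinite P] [SigmaFinite Q] (E : Set Ω)
    (hJ : ∫⁻ ω, P.rnDeriv (P + Q) ω ^ α * Q.rnDeriv (P + Q) ω ^ (1 - α) ∂(P + Q) ≠ ∞) :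
    P E ≤ (∫⁻ ω, P.rnDeriv (P + Q) ω ^ α * Q.rnDeriv (P + Q) ω ^ (1 - α) ∂(P + Q)) ^ α⁻¹ *
      Q E ^ ((α - 1) / α) := by
  have hP : P ≪ P + Q := (Measure.le_add_right le_rfl).absolutelyContinuous
  have hQ : Q ≪ P + Q := (Measure.le_add_left le_rfl).absolutelyContinuous
  have hEJ := setLIntegral_le_lintegral (μ := P + Q) E
    fun ω ↦ P.rnDeriv (P + Q) ω ^ α * Q.rnDeriv (P + Q) ω ^ (1 - α)
  have holder := lintegral_le_lintegral_rpow_mul_rpow hα (μ := (P + Q).restrict E)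
    (P.measurable_rnDeriv (P + Q)).aemeasurable (Q.measurable_rnDeriv (P + Q)).aemeasurable
    (ae_restrict_of_ae (Q.rnDeriv_ne_top (P + Q))) (ne_top_of_le_ne_top hJ hEJ)
  rw [Measure.setLIntegral_rnDeriv hP, Measure.setLIntegral_rnDeriv hQ] at holder
  exact holder.trans (by gcongr)

lemma log_measure_le_mul_upperAdd_renyiDiv (hα : 1 < α) (P Q : Measure Ω)
    [SigmaFinite P] [SigmaFinite Q] (E : Set Ω) :
    ENNReal.log (P E) ≤
      (((α - 1) / α : ℝ) : EReal) * upperAdd (renyiDiv α P Q) (ENNReal.log (Q E)) := by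
  have hc : 0 < (α - 1) / α := div_pos (by linarith) (by linarith)
  have hc' : (0 : EReal) ≤ ((α - 1) / α : ℝ) := EReal.coe_nonneg.2 hc.le
  by_cases hJ : ∫⁻ ω, P.rnDeriv (P + Q) ω ^ α * Q.rnDeriv (P + Q) ω ^ (1 - α) ∂(P + Q) = ∞
  · have hD : renyiDiv α P Q = ⊤ := by
      rw [renyiDiv, hJ, ENNReal.log_top, EReal.coe_mul_top_of_pos (inv_pos.2 (by linarith))]
    rw [hD, top_upperAdd, EReal.coe_mul_top_of_pos hc]
    exact le_top
  calc ENNReal.log (P E)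
      ≤ ENNReal.log ((∫⁻ ω, P.rnDeriv (P + Q) ω ^ α * Q.rnDeriv (P + Q) ω ^ (1 - α)
          ∂(P + Q)) ^ α⁻¹ * Q E ^ ((α - 1) / α)) :=
        ENNReal.log_monotone (measure_le_lintegral_rnDeriv_rpow_mul_rpow hα P Q E hJ)
    _ = (((α - 1) / α : ℝ) : EReal) * (renyiDiv α P Q + ENNReal.log (Q E)) := by
        have hinv : α⁻¹ = (α - 1) / α * (α - 1)⁻¹ := by
          have : α - 1 ≠ 0 := by linarith
          field_simp
        rw [ENNReal.log_mul_add, ENNReal.log_rpow, ENNReal.log_rpow, renyiDiv,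
          EReal.left_distrib_of_nonneg_of_ne_top hc' (EReal.coe_ne_top _), ← mul_assoc,
          ← EReal.coe_mul, ← hinv]
    _ ≤ _ := mul_le_mul_of_nonneg_left (add_le_upperAdd _ _) hc'

lemma prod_le_of_forall_section_le {μ : Measure 𝓦} [SFinite μ] (ν : Measure 𝓧)
    [IsProbabilityMeasure ν] {E : Set (𝓦 × 𝓧)} (hE : MeasurableSet E) {s : ℝ≥0∞}
    (hs : ∀ x, μ ((·, x) ⁻¹' E) ≤ s) : μ.prod ν E ≤ s := by
  calc μ.prod ν E = ∫⁻ x, μ ((·, x) ⁻¹' E) ∂ν := Measure.prod_apply_symm hE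
    _ ≤ ∫⁻ _, s ∂ν := lintegral_mono hs
    _ = s := by simp

theorem measure_le_exp_mul_upperAdd_sibsonMI (hα : 1 < α) (P : Measure (𝓦 × 𝓧))
    [IsFiniteMeasure P] {E : Set (𝓦 × 𝓧)} (hE : MeasurableSet E) {s : ℝ≥0∞}
    (hs : ∀ x, P.fst ((·, x) ⁻¹' E) ≤ s) :
    P E ≤ EReal.exp
      ((((α - 1) / α : ℝ) : EReal) * upperAdd (sibsonMI α P) (ENNReal.log s)) := by
  have hc : (0 : EReal) < ((α - 1) / α : ℝ) :=
    EReal.coe_pos.2 (div_pos (by linarith) (by linarith))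
  rw [← ENNReal.exp_log (P E), EReal.exp_le_exp_iff,
    ← EReal.div_le_iff_le_mul hc (EReal.coe_ne_top _)]
  refine le_upperAdd_iInf fun Q ↦ ?_
  rw [EReal.div_le_iff_le_mul hc (EReal.coe_ne_top _)]
  calc ENNReal.log (P E) ≤ _ :=
        log_measure_le_mul_upperAdd_renyiDiv hα P (P.fst.prod (Q : Measure 𝓧)) E
    _ ≤ _ := mul_le_mul_of_nonneg_left (upperAdd_le_upperAdd_left _
        (ENNReal.log_monotone (prod_le_of_forall_section_le _ hE hs))) hc.le

end Renyi

section Leakage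

variable {𝓦 𝓧 ι : Type*} [MeasurableSpace 𝓦] [MeasurableSpace 𝓧]

/-- The kernel from `𝓦` to a finite alphabet with prescribed measurable weights: the conditional
law of the letter `U` given `W` in the definition of maximal leakage. -/
noncomputable def weightKernel {n : ℕ} (c : Fin n → 𝓦 → ℝ≥0∞) : Kernel 𝓦 (Fin n) :=
  (Kernel.const 𝓦 Measure.count).withDensity fun w u ↦ c u w

lemma weightKernel_apply {n : ℕ} {c : Fin n → 𝓦 → ℝ≥0∞} (hc : ∀ u, Measurable (c u)) (w : 𝓦)
    (s : Set (Fin n)) : weightKernel c w s = ∫⁻ u in s, c u w ∂Measure.count := by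
  rw [weightKernel, Kernel.withDensity_apply' _ (measurable_from_prod_countable_left hc),
    Kernel.const_apply]

lemma weightKernel_apply_singleton {n : ℕ} {c : Fin n → 𝓦 → ℝ≥0∞} (hc : ∀ u, Measurable (c u))
    (w : 𝓦) (u : Fin n) : weightKernel c w {u} = c u w := by
  simp [weightKernel_apply hc]

lemma isMarkovKernel_weightKernel {n : ℕ} {c : Fin n → 𝓦 → ℝ≥0∞} (hc : ∀ u, Measurable (c u))
    (hsum : ∀ w, ∑ u, c u w = 1) : IsMarkovKernel (weightKernel c) :=
  ⟨fun w ↦ ⟨by simp [weightKernel_apply hc, lintegral_count, hsum]⟩⟩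

lemma parallelComp_deterministic_apply_diagonal {n : ℕ} (η : Kernel 𝓦 (Fin n)) [IsSFiniteKernel η]
    {g : 𝓧 → Fin n} (hg : Measurable g) (P : Measure (𝓦 × 𝓧)) :
    ((η ∥ₖ Kernel.deterministic g hg) ∘ₘ P) {q : Fin n × Fin n | q.1 = q.2} =
      ∫⁻ p, η p.1 {g p.2} ∂P := by
  have hdiag : MeasurableSet {q : Fin n × Fin n | q.1 = q.2} :=
    measurableSet_eq_fun measurable_fst measurable_snd
  rw [Measure.bind_apply hdiag (Kernel.aemeasurable _)]
  refine lintegral_congr fun p ↦ ?_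
  rw [Kernel.parallelComp_apply, Measure.prod_apply_symm hdiag, Kernel.deterministic_apply,
    lintegral_dirac]
  rfl

lemma lintegral_guess_div_iSup_le_exp_maximalLeakage [Fintype ι] (P : Measure (𝓦 × 𝓧))
    {c : ι → 𝓦 → ℝ≥0∞} (hc : ∀ u, Measurable (c u)) (hsum : ∀ w, ∑ u, c u w = 1)
    (g : SimpleFunc 𝓧 ι) :
    (∫⁻ p, c (g p.2) p.1 ∂P) / ⨆ u, ∫⁻ w, c u w ∂P.fst ≤ EReal.exp (maximalLeakage P) := by
  let e := Fintype.equivFin ι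
  let c' : Fin (Fintype.card ι) → 𝓦 → ℝ≥0∞ := fun k ↦ c (e.symm k)
  let ζ := Kernel.deterministic (g.map e) (g.map e).measurable
  have hc' : ∀ k, Measurable (c' k) := fun k ↦ hc (e.symm k)
  have hη : IsMarkovKernel (weightKernel c') :=
    isMarkovKernel_weightKernel hc' fun w ↦ (e.symm.sum_comp fun u ↦ c u w).trans (hsum w)
  have hjoint : ((weightKernel c' ∥ₖ ζ) ∘ₘ P) {q | q.1 = q.2} = ∫⁻ p, c (g p.2) p.1 ∂P := by
    simp [ζ, parallelComp_deterministic_apply_diagonal, weightKernel_apply_singleton hc', c']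
  have hmarginal : ⨆ k, (weightKernel c' ∘ₘ P.fst) {k} = ⨆ u, ∫⁻ w, c u w ∂P.fst := by
    refine e.symm.iSup_congr fun k ↦ ?_
    rw [Measure.bind_apply (measurableSet_singleton k) (Kernel.aemeasurable _)]
    simp only [weightKernel_apply_singleton hc', c']
  rw [← ENNReal.exp_log (_ / _), EReal.exp_le_exp_iff, ← hjoint, ← hmarginal]
  exact le_iSup₂_of_le _ (weightKernel c')
    (le_iSup₂_of_le ζ hη (le_iSup_of_le inferInstance le_rfl))

/-- Dummy letters, so numerous that none of them is likelier than `δ`, absorb the missing mass. -/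
lemma lintegral_guess_le_exp_maximalLeakage_mul [Fintype ι] (P : Measure (𝓦 × 𝓧))
    [IsFiniteMeasure P] {c : ι → 𝓦 → ℝ≥0∞} (hc : ∀ u, Measurable (c u))
    (hsum : ∀ w, ∑ u, c u w ≤ 1) {δ : ℝ≥0∞} (hδ₀ : δ ≠ 0) (hδ : δ ≠ ∞)
    (hcδ : ∀ u, ∫⁻ w, c u w ∂P.fst ≤ δ) (g : SimpleFunc 𝓧 ι) :
    ∫⁻ p, c (g p.2) p.1 ∂P ≤ EReal.exp (maximalLeakage P) * δ := by
  obtain ⟨M, hM₀, hM⟩ := ENNReal.exists_nat_pos_inv_mul_lt (measure_ne_top P.fst Set.univ) hδ₀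
  have hM₀' : (M : ℝ≥0∞) ≠ 0 := by exact_mod_cast hM₀.ne'
  let c' : ι ⊕ Fin M → 𝓦 → ℝ≥0∞ := Sum.elim c fun _ w ↦ (M : ℝ≥0∞)⁻¹ * (1 - ∑ u, c u w)
  have hc' : ∀ u, Measurable (c' u) := by
    rintro (u | _)
    · exact hc u
    · exact (measurable_const.sub (Finset.measurable_sum _ fun u _ ↦ hc u)).const_mul _
  have hsum' : ∀ w, ∑ u, c' u w = 1 := fun w ↦ by
    simp only [c', Fintype.sum_sum_type, Sum.elim_inl, Sum.elim_inr, Finset.sum_const,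
      Finset.card_univ, Fintype.card_fin, nsmul_eq_mul]
    rw [ENNReal.mul_inv_cancel_left hM₀' (ENNReal.natCast_ne_top M),
      add_tsub_cancel_of_le (hsum w)]
  have hdummy : ∫⁻ w, (M : ℝ≥0∞)⁻¹ * (1 - ∑ u, c u w) ∂P.fst ≤ δ :=
    calc ∫⁻ w, (M : ℝ≥0∞)⁻¹ * (1 - ∑ u, c u w) ∂P.fst
        ≤ ∫⁻ _, (M : ℝ≥0∞)⁻¹ ∂P.fst := lintegral_mono fun w ↦ mul_le_of_le_one_right' tsub_le_self
      _ ≤ δ := by simpa using hM.le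
  have hc'δ : ⨆ u, ∫⁻ w, c' u w ∂P.fst ≤ δ := iSup_le (Sum.forall.2 ⟨hcδ, fun _ ↦ hdummy⟩)
  rw [← ENNReal.div_le_iff hδ₀ hδ]
  calc (∫⁻ p, c (g p.2) p.1 ∂P) / δ
      ≤ (∫⁻ p, c' (g.map Sum.inl p.2) p.1 ∂P) / ⨆ u, ∫⁻ w, c' u w ∂P.fst :=
        ENNReal.div_le_div_left hc'δ _
    _ ≤ _ := lintegral_guess_div_iSup_le_exp_maximalLeakage P hc' hsum' (g.map Sum.inl)

lemma measurableSet_simpleSections (A : SimpleFunc 𝓧 {s : Set 𝓦 // MeasurableSet s}) :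
    MeasurableSet {p : 𝓦 × 𝓧 | p.1 ∈ (A p.2 : Set 𝓦)} :=
  (A.comp Prod.snd measurable_snd).measurableSet_cut
    (fun (p : 𝓦 × 𝓧) (s : {s : Set 𝓦 // MeasurableSet s}) ↦ p.1 ∈ (s : Set 𝓦))
    fun s ↦ measurable_fst s.2

/-- The number `N` of sections is irrelevant: among letters of weight `1_{A x} / N`, both the
success probability and the largest letter probability carry the factor `1 / N`. -/
lemma measure_simpleSections_le (P : Measure (𝓦 × 𝓧)) [IsFiniteMeasure P]
    (A : SimpleFunc 𝓧 {s : Set 𝓦 // MeasurableSet s}) {δ : ℝ≥0∞} (hδ₀ : δ ≠ 0) (hδ : δ ≠ ∞)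
    (hA : ∀ x, P.fst (A x) ≤ δ) :
    P {p | p.1 ∈ (A p.2 : Set 𝓦)} ≤ EReal.exp (maximalLeakage P) * δ := by
  cases isEmpty_or_nonempty 𝓧
  · simp [Set.eq_empty_of_isEmpty]
  have : Nonempty A.range := ⟨⟨A (Classical.arbitrary 𝓧), A.mem_range_self _⟩⟩
  let N : ℝ≥0∞ := Fintype.card A.range
  have hN₀ : N ≠ 0 := Nat.cast_ne_zero.2 Fintype.card_ne_zero
  have hN : N ≠ ∞ := ENNReal.natCast_ne_top _
  let c : A.range → 𝓦 → ℝ≥0∞ := fun k ↦ (k : Set 𝓦).indicator fun _ ↦ N⁻¹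
  let g : SimpleFunc 𝓧 A.range :=
    { toFun := fun x ↦ ⟨A x, A.mem_range_self x⟩
      measurableSet_fiber' := fun k ↦ by
        simpa [Set.preimage, Subtype.ext_iff] using A.measurableSet_fiber k
      finite_range' := Set.toFinite _ }
  have hsum : ∀ w, ∑ k, c k w ≤ 1 := fun w ↦
    calc ∑ k, c k w ≤ ∑ _k : A.range, N⁻¹ :=
          Finset.sum_le_sum fun k _ ↦ Set.indicator_le_self _ _ w
      _ = 1 := by simpa [N] using ENNReal.mul_inv_cancel hN₀ hN
  have hletter : ∀ k, ∫⁻ w, c k w ∂P.fst ≤ N⁻¹ * δ := by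
    rintro ⟨k, hk⟩
    obtain ⟨x, rfl⟩ := SimpleFunc.mem_range.1 hk
    rw [lintegral_indicator_const (A x).2]
    gcongr
    exact hA x
  have hsuccess : ∫⁻ p, c (g p.2) p.1 ∂P = N⁻¹ * P {p | p.1 ∈ (A p.2 : Set 𝓦)} :=
    lintegral_indicator_const (measurableSet_simpleSections A) _
  have key := lintegral_guess_le_exp_maximalLeakage_mul P
    (fun k ↦ measurable_const.indicator k.1.2) hsum (mul_ne_zero (ENNReal.inv_ne_zero.2 hN) hδ₀)
    (ENNReal.mul_ne_top (ENNReal.inv_ne_top.2 hN₀) hδ) hletter g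
  rwa [hsuccess, mul_left_comm,
    ENNReal.mul_le_mul_iff_right (ENNReal.inv_ne_zero.2 hN) (ENNReal.inv_ne_top.2 hN₀)] at key

/-- The sets in `𝓦 × 𝓧` with finitely many distinct sections over `𝓧`, each of them measurable and
occurring over a measurable set. They form an algebra that generates the product `σ`-algebra. -/
def simpleSectionSets (𝓦 𝓧 : Type*) [MeasurableSpace 𝓦] [MeasurableSpace 𝓧] :
    Set (Set (𝓦 × 𝓧)) :=
  Set.range fun A : SimpleFunc 𝓧 {s : Set 𝓦 // MeasurableSet s} ↦ {p | p.1 ∈ (A p.2 : Set 𝓦)}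

lemma isSetAlgebra_simpleSectionSets : IsSetAlgebra (simpleSectionSets 𝓦 𝓧) where
  empty_mem := ⟨SimpleFunc.const 𝓧 ⊥, rfl⟩
  compl_mem := by
    rintro _ ⟨A, rfl⟩
    exact ⟨A.map compl, rfl⟩
  union_mem := by
    rintro _ _ ⟨A, rfl⟩ ⟨B, rfl⟩
    exact ⟨A ⊔ B, rfl⟩

lemma generateFrom_simpleSectionSets :
    MeasurableSpace.generateFrom (simpleSectionSets 𝓦 𝓧) = Prod.instMeasurableSpace := by
  refine le_antisymm (MeasurableSpace.generateFrom_le ?_) ?_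
  · rintro _ ⟨A, rfl⟩
    exact measurableSet_simpleSections A
  · rw [← generateFrom_prod]
    refine MeasurableSpace.generateFrom_mono ?_
    rintro _ ⟨S, hS, T, hT, rfl⟩
    classical
    refine ⟨SimpleFunc.piecewise T hT (SimpleFunc.const 𝓧 ⟨S, hS⟩) (SimpleFunc.const 𝓧 ⊥), ?_⟩
    ext p
    by_cases hp : p.2 ∈ T <;> simp [hp, -MeasurableSet.mem_coe]

lemma mul_measure_section_gt_le_prod_symmDiff (μ : Measure 𝓦) [SFinite μ] (ν : Measure 𝓧)
    [SFinite ν] {E F : Set (𝓦 × 𝓧)} (hE : MeasurableSet E) (hF : MeasurableSet F) {s : ℝ≥0∞}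
    (hs : ∀ x, μ ((·, x) ⁻¹' E) ≤ s) (ε : ℝ≥0∞) :
    ε * ν {x | s + ε < μ ((·, x) ⁻¹' F)} ≤ μ.prod ν (symmDiff E F) := by
  have hexcess : ∀ x, s + ε < μ ((·, x) ⁻¹' F) → ε ≤ μ ((·, x) ⁻¹' symmDiff E F) := by
    intro x hx
    have hFx : μ ((·, x) ⁻¹' F) ≤ s + μ ((·, x) ⁻¹' symmDiff E F) :=
      calc μ ((·, x) ⁻¹' F) ≤ μ ((·, x) ⁻¹' E ∪ (·, x) ⁻¹' symmDiff E F) :=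
            measure_mono fun w hw ↦ (em ((w, x) ∈ E)).imp_right fun hwE ↦ .inr ⟨hw, hwE⟩
        _ ≤ _ := (measure_union_le _ _).trans (by gcongr; exact hs x)
    exact (lt_of_add_lt_add_left (hx.trans_le hFx)).le
  rw [Measure.prod_apply_symm (hE.symmDiff hF)]
  exact (mul_le_mul_right (measure_mono hexcess) ε).trans
    (mul_meas_ge_le_lintegral (measurable_measure_prodMk_right (hE.symmDiff hF)) ε)

lemma exists_simpleSections_approx (P : Measure (𝓦 × 𝓧)) [IsFiniteMeasure P] {E : Set (𝓦 × 𝓧)}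
    (hE : MeasurableSet E) {s : ℝ≥0∞} (hs : ∀ x, P.fst ((·, x) ⁻¹' E) ≤ s) {ε : ℝ≥0}
    (hε : 0 < ε) :
    ∃ A : SimpleFunc 𝓧 {s : Set 𝓦 // MeasurableSet s}, (∀ x, P.fst (A x) ≤ s + ε) ∧
      P E ≤ P {p | p.1 ∈ (A p.2 : Set 𝓦)} + ε := by
  classical
  let η : ℝ≥0 := ε * ε / (1 + ε)
  have hη : 0 < η := by positivity
  have hηε : η + η / ε = ε := by simp only [η]; field_simp; ring
  obtain ⟨_, ⟨A, rfl⟩, hA⟩ := (Measure.MeasureDense.of_generateFrom_isSetAlgebra_finite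
    (μ := P + P.fst.prod P.snd) isSetAlgebra_simpleSectionSets
    generateFrom_simpleSectionSets.symm).approx E hE (measure_ne_top _ _) η hη
  rw [ENNReal.ofReal_coe_nnreal, Measure.add_apply] at hA
  let bad : Set 𝓧 := {x | s + ε < P.fst (A x)}
  have hbad_meas : MeasurableSet bad := A.measurableSet_preimage {t | s + ε < P.fst t}
  have hbad : P.snd bad ≤ η / ε := by
    rw [ENNReal.le_div_iff_mul_le (by simp [hε.ne']) (by simp), mul_comm]
    exact (mul_measure_section_gt_le_prod_symmDiff P.fst P.snd hE
      (measurableSet_simpleSections A) hs ε).trans (le_add_self.trans hA.le)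
  let B := SimpleFunc.piecewise bad hbad_meas (SimpleFunc.const 𝓧 ⊥) A
  refine ⟨B, fun x ↦ ?_, ?_⟩
  · by_cases hx : x ∈ bad
    · simp [B, hx]
    · simpa [B, hx] using not_lt.1 hx
  have hcover : E ⊆ {p | p.1 ∈ (B p.2 : Set 𝓦)} ∪
      (symmDiff E {p | p.1 ∈ (A p.2 : Set 𝓦)} ∪ Prod.snd ⁻¹' bad) := by
    intro p hp
    by_cases hpb : p.2 ∈ bad
    · exact .inr (.inr hpb)
    by_cases hpA : p.1 ∈ (A p.2 : Set 𝓦)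
    · exact .inl (by simpa [B, hpb] using hpA)
    · exact .inr (.inl (.inl ⟨hp, hpA⟩))
  calc P E ≤ P {p | p.1 ∈ (B p.2 : Set 𝓦)} +
        (P (symmDiff E {p | p.1 ∈ (A p.2 : Set 𝓦)}) + P (Prod.snd ⁻¹' bad)) :=
        (measure_mono hcover).trans ((measure_union_le _ _).trans
          (by gcongr; exact measure_union_le _ _))
    _ ≤ P {p | p.1 ∈ (B p.2 : Set 𝓦)} + (η + η / ε) := by
        rw [← Measure.snd_apply hbad_meas]
        gcongr
        exact le_self_add.trans hA.le
    _ = P {p | p.1 ∈ (B p.2 : Set 𝓦)} + ε := by rw [← ENNReal.coe_div hε.ne']; norm_cast; rw [hηε]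

theorem measure_le_exp_upperAdd_maximalLeakage (P : Measure (𝓦 × 𝓧)) [IsFiniteMeasure P]
    {E : Set (𝓦 × 𝓧)} (hE : MeasurableSet E) {s : ℝ≥0∞} (hs : ∀ x, P.fst ((·, x) ⁻¹' E) ≤ s) :
    P E ≤ EReal.exp (upperAdd (maximalLeakage P) (ENNReal.log s)) := by
  rcases eq_or_ne (maximalLeakage P) ⊤ with hL | hL
  · simp [hL, top_upperAdd]
  rcases eq_or_ne s ∞ with rfl | hs_top
  · simp [upperAdd]
  have happrox : ∀ ε : ℝ≥0, 0 < ε → P E ≤ EReal.exp (maximalLeakage P) * (s + ε) + ε := by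
    intro ε hε
    obtain ⟨A, hA, hEA⟩ := exists_simpleSections_approx P hE hs hε
    refine hEA.trans (add_le_add_left (measure_simpleSections_le P A ?_ ?_ hA) _)
    · simp [hε.ne']
    · simp [hs_top]
  have hcont : Continuous fun ε : ℝ≥0 ↦ EReal.exp (maximalLeakage P) * (s + ε) + ε :=
    ((ENNReal.continuous_const_mul (by simpa using hL)).comp (by fun_prop)).add (by fun_prop)
  have hlim : P E ≤ EReal.exp (maximalLeakage P) * (s + (0 : ℝ≥0)) + (0 : ℝ≥0) :=
    ge_of_tendsto (hcont.continuousWithinAt (s := Set.Ioi 0))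
      (eventually_mem_nhdsWithin.mono happrox)
  calc P E ≤ EReal.exp (maximalLeakage P) * s := by simpa using hlim
    _ = EReal.exp (maximalLeakage P + ENNReal.log s) := by rw [EReal.exp_add, ENNReal.exp_log]
    _ ≤ _ := EReal.exp_monotone (add_le_upperAdd _ _)

end Leakage

end BayesBound

open BayesBound in
theorem mainTheorem1_general {𝓦 𝓧 𝓥 : Type*} [MeasurableSpace 𝓦] [MeasurableSpace 𝓧]
    [MeasurableSpace 𝓥] (P : Measure (𝓦 × 𝓧)) [IsProbabilityMeasure P]
    (ℓ : 𝓦 → 𝓥 → ℝ≥0) (hℓ : Measurable (Function.uncurry ℓ)) :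
    (∀ α : ℝ, 1 < α → ∀ ρ : ℝ, 0 < ρ →
      (ρ : EReal) * (1 - (EReal.exp ((((α - 1) / α : ℝ) : EReal) *
          upperAdd (sibsonMI α P) (ENNReal.log (smallBall ℓ P.fst ρ))) : EReal))
        ≤ (bayesianRisk ℓ P : EReal)) ∧
    (⨆ (ρ : ℝ) (_ : 0 < ρ),
      (ρ : EReal) * (1 - (EReal.exp (upperAdd (maximalLeakage P)
          (ENNReal.log (smallBall ℓ P.fst ρ))) : EReal)))
        ≤ (bayesianRisk ℓ P : EReal) := by
  have hball (φ : 𝓧 → 𝓥) (ρ : ℝ) (x : 𝓧) :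
      P.fst ((·, x) ⁻¹' {p | (ℓ p.1 (φ p.2) : ℝ) < ρ}) ≤ smallBall ℓ P.fst ρ :=
    le_iSup (fun v ↦ P.fst {w | (ℓ w v : ℝ) < ρ}) (φ x)
  refine ⟨fun α hα ρ hρ ↦ ?_, iSup₂_le fun ρ hρ ↦ ?_⟩
  · exact coe_mul_one_sub_le_bayesianRisk hℓ P hρ.le fun φ hφ ↦
      measure_le_exp_mul_upperAdd_sibsonMI hα P (measurableSet_loss_lt hℓ hφ ρ) (hball φ ρ)
  · exact coe_mul_one_sub_le_bayesianRisk hℓ P hρ.le fun φ hφ ↦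
      measure_le_exp_upperAdd_maximalLeakage P (measurableSet_loss_lt hℓ hφ ρ) (hball φ ρ)

theorem mainTheorem1 {𝓦 𝓧 𝓥 : Type*} [MeasurableSpace 𝓦] [MeasurableSpace 𝓧] [MeasurableSpace 𝓥]
    (π : Measure 𝓦) [IsProbabilityMeasure π] (κ : Kernel 𝓦 𝓧) [IsMarkovKernel κ]
    (ℓ : 𝓦 → 𝓥 → ℝ≥0) (hℓ : Measurable (Function.uncurry ℓ)) :
    (∀ α : ℝ, 1 < α → ∀ ρ : ℝ, 0 < ρ →
      (ρ : EReal) * (1 - (EReal.exp ((((α - 1) / α : ℝ) : EReal) *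
          BayesBound.upperAdd (BayesBound.sibsonMI α (π ⊗ₘ κ))
            (ENNReal.log (BayesBound.smallBall ℓ π ρ))) : EReal))
        ≤ (BayesBound.bayesianRisk ℓ (π ⊗ₘ κ) : EReal)) ∧
    (⨆ (ρ : ℝ) (_ : 0 < ρ),
      (ρ : EReal) * (1 - (EReal.exp (BayesBound.upperAdd
          (BayesBound.maximalLeakage (π ⊗ₘ κ))
            (ENNReal.log (BayesBound.smallBall ℓ π ρ))) : EReal)))
        ≤ (BayesBound.bayesianRisk ℓ (π ⊗ₘ κ) : EReal) := by
  simpa only [Measure.fst_compProd] using mainTheorem1_general (π ⊗ₘ κ) ℓ hℓ
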